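/- Let $B=\{x\in\mathbb{R}^2:|x|<1\}$ be the open unit disc, let $\hat x=x/|x|$ for $x\neq0$, and write $(\nabla v)_{ij}=\partial_j v_i$ for the weak gradient of $v\in W^{1,2}(B,\mathbb{R}^2)$. For $\varepsilon\ge 1$ let $$\mathbb{D}_\varepsilon(v)=\int_B \Big(\frac1\varepsilon\,|\nabla v(x)^T\hat x|^2+\varepsilon\,|(\operatorname{adj}\nabla v(x))\,\hat x|^2\Big)\,dx,\qquad v\in W^{1,2}(B,\mathbb{R}^2),$$ where $\operatorname{adj}$ is the adjugate matrix and $|\cdot|$ the Euclidean norm. Let $$\mathcal{A}^c=\{v\in W^{1,2}(B,\mathbb{R}^2): \det\nabla v=1 \text{ a.e. in } B,\ v=\mathrm{Id}\text{ on }\partial B \text{ in the trace sense}\},$$ where the boundary condition means $v-\mathrm{Id}\in W^{1,2}_0(B,\mathbb{R}^2)$, the closure of $C_c^\infty(B,\mathbb{R}^2)$ in $W^{1,2}(B,\mathbb{R}^2)$. **Theorem.** If $1<\varepsilon<\sqrt2$, then the identity is a global minimizer of $\mathbb{D}_\varepsilon$ in the class $\mathcal{A}^c$, and it is the only one: every global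 minimizer of $\mathbb{D}_\varepsilon$ in $\mathcal{A}^c$ equals $\mathrm{Id}$ a.e. in $B$. If $\varepsilon=\sqrt2$, then the identity is a global minimizer of $\mathbb{D}_{\sqrt2}$ in $\mathcal{A}^c$ (not necessarily the only one). -/

import Mathlib

open MeasureTheory Filter Topology
open scoped ContDiff ENNReal

namespace Buckling

/-- The Euclidean plane. -/
abbrev Plane : Type := EuclideanSpace ℝ (Fin 2)

/-- The open unit disc `B`. -/
abbrev disc : Set Plane := Metric.ball 0 1

/-- Lebesgue measure on the unit disc. -/
noncomputable abbrev discMeasure : Measure Plane := volume.restrict disc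

/-- `φ` is a smooth function with compact support contained in the open unit disc. -/
structure IsTestFunction {F : Type*} [NormedAddCommGroup F] [NormedSpace ℝ F]
    (φ : Plane → F) : Prop where
  contDiff : ContDiff ℝ ∞ φ
  hasCompactSupport : HasCompactSupport φ
  tsupport_subset : tsupport φ ⊆ disc

/-- The classical partial derivative `∂_j φ`. -/
noncomputable def partialDeriv {F : Type*} [NormedAddCommGroup F] [NormedSpace ℝ F]
    (j : Fin 2) (φ : Plane → F) (x : Plane) : F :=
  fderiv ℝ φ x (EuclideanSpace.single j 1)

/-- `G` is a square-integrable weak gradient of `v` on the disc, `G_{ij} = ∂_j v_i`. -/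
structure HasWeakGradient (v : Plane → Plane) (G : Plane → Matrix (Fin 2) (Fin 2) ℝ) :
    Prop where
  memLp : ∀ i j, MemLp (fun x => G x i j) 2 discMeasure
  integral_eq : ∀ i j, ∀ φ : Plane → ℝ, IsTestFunction φ →
    ∫ x in disc, v x i * partialDeriv j φ x = - ∫ x in disc, G x i j * φ x

/-- `v` belongs to the Sobolev space `W^{1,2}(B, ℝ²)`. -/
def MemW12 (v : Plane → Plane) : Prop :=
  MemLp v 2 discMeasure ∧ ∃ G, HasWeakGradient v G

open Classical in
/-- The weak gradient `∇v` of `v ∈ W^{1,2}(B, ℝ²)`, which is determined up to null sets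
(and `0` outside `W^{1,2}`). -/
noncomputable def weakGradient (v : Plane → Plane) : Plane → Matrix (Fin 2) (Fin 2) ℝ :=
  if h : ∃ G, HasWeakGradient v G then h.choose else 0

theorem MemW12.hasWeakGradient {v : Plane → Plane} (hv : MemW12 v) :
    HasWeakGradient v (weakGradient v) := by
  unfold weakGradient
  rw [dif_pos hv.2]
  exact hv.2.choose_spec

/-- Weak gradients are unique up to null sets. -/
theorem HasWeakGradient.ae_eq {v : Plane → Plane} {G H : Plane → Matrix (Fin 2) (Fin 2) ℝ}
    (hG : HasWeakGradient v G) (hH : HasWeakGradient v H) : G =ᵐ[discMeasure] H := by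
  have : IsFiniteMeasure discMeasure :=
    ⟨by simp [discMeasure]⟩
  have key : ∀ i j, ∀ᵐ x ∂discMeasure, G x i j = H x i j := by
    intro i j
    have hGi : IntegrableOn (fun x => G x i j) disc := (hG.memLp i j).integrable (by norm_num)
    have hHi : IntegrableOn (fun x => H x i j) disc := (hH.memLp i j).integrable (by norm_num)
    have h0 : ∀ᵐ x ∂(volume : Measure Plane), x ∈ disc → G x i j - H x i j = 0 := by
      refine Metric.isOpen_ball.ae_eq_zero_of_integral_contDiff_smul_eq_zero
        (f := fun x => G x i j - H x i j) (hGi.sub hHi).locallyIntegrableOn ?_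
      intro φ hφ hc hs
      have e := (hG.integral_eq i j φ ⟨hφ, hc, hs⟩).symm.trans
        (hH.integral_eq i j φ ⟨hφ, hc, hs⟩)
      obtain ⟨C, hC⟩ := hc.exists_bound_of_continuous hφ.continuous
      have hm : AEStronglyMeasurable φ discMeasure := hφ.continuous.aestronglyMeasurable
      have i1 : Integrable (fun x => G x i j * φ x) discMeasure :=
        Integrable.mul_bdd (c := C) hGi hm (ae_of_all _ hC)
      have i2 : Integrable (fun x => H x i j * φ x) discMeasure :=
        Integrable.mul_bdd (c := C) hHi hm (ae_of_all _ hC)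
      have hz : ∫ x in disc, φ x • (G x i j - H x i j) = 0 := by
        have : (fun x => φ x • (G x i j - H x i j))
            = fun x => G x i j * φ x - H x i j * φ x := by
          ext x; simp only [smul_eq_mul]; ring
        rw [this, integral_sub i1 i2, sub_eq_zero]
        exact neg_injective e
      rw [← hz]
      refine (setIntegral_eq_integral_of_forall_compl_eq_zero ?_).symm
      intro x hx
      rw [image_eq_zero_of_notMem_tsupport (fun h => hx (hs h)), zero_smul]
    rw [ae_restrict_iff' measurableSet_ball]
    filter_upwards [h0] with x hx hxd
    exact sub_eq_zero.mp (hx hxd)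
  have := ae_all_iff.2 fun i => ae_all_iff.2 (key i)
  filter_upwards [this] with x hx
  ext i j
  exact hx i j

/-- `u` belongs to `W_0^{1,2}(B, ℝ²)`, the closure of `C_c^∞(B, ℝ²)` in `W^{1,2}(B, ℝ²)`. -/
def MemW120 (u : Plane → Plane) : Prop :=
  MemW12 u ∧ ∃ ψ : ℕ → Plane → Plane, (∀ n, IsTestFunction (ψ n)) ∧
    Tendsto (fun n => eLpNorm (ψ n - u) 2 discMeasure) atTop (𝓝 0) ∧
    ∀ i j, Tendsto (fun n => eLpNorm
      (fun x => partialDeriv j (ψ n) x i - weakGradient u x i j) 2 discMeasure) atTop (𝓝 0)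

/-- The maps in `W^{1,2}(B, ℝ²)` that equal the identity on `∂B` in the trace sense, that is,
`v - Id ∈ W_0^{1,2}(B, ℝ²)`. -/
def identityBoundary : Set (Plane → Plane) :=
  {v | MemW12 v ∧ MemW120 (v - id)}

/-- The maps in `W^{1,2}(B, ℝ²)` with `det ∇v = 1` almost everywhere. -/
def measurePreservingMaps : Set (Plane → Plane) :=
  {v | MemW12 v ∧ ∀ᵐ x ∂discMeasure, (weakGradient v x).det = 1}

/-- The incompressible maps with identity boundary values. -/
def admissible : Set (Plane → Plane) := measurePreservingMaps ∩ identityBoundary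

/-- The unit vector `x / |x|` (and `0` at the origin). -/
noncomputable def radial (x : Plane) : Plane := ‖x‖⁻¹ • x

/-- The integrand `ε⁻¹ |ξᵀ x̂|² + ε |(adj ξ) x̂|²`, with Euclidean norms. -/
noncomputable def integrand (ε : ℝ) (x : Plane) (ξ : Matrix (Fin 2) (Fin 2) ℝ) : ℝ :=
  ε⁻¹ * ‖Matrix.toEuclideanLin ξ.transpose (radial x)‖ ^ 2
    + ε * ‖Matrix.toEuclideanLin ξ.adjugate (radial x)‖ ^ 2

/-- The energy `𝔻_ε(v)`. -/
noncomputable def energy (ε : ℝ) (v : Plane → Plane) : ℝ :=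
  ∫ x in disc, integrand ε x (weakGradient v x)

/-- `u` is a global minimizer of `𝔻_ε` among the admissible maps. -/
def IsGlobalMinimizer (ε : ℝ) (u : Plane → Plane) : Prop :=
  u ∈ admissible ∧ ∀ v ∈ admissible, energy ε u ≤ energy ε v

end Buckling

/-! Write an admissible map as `v = Id + u` and put `H = ∇u`. Expanding the integrand at the
identity gives the linear terms `2ε tr H - 2(ε - ε⁻¹) x̂·Hx̂` and the quadratic terms `ε⁻¹|Hᵀx̂|² +
ε|(adj H)x̂|²`. In two dimensions `|Hᵀx̂|² + |(adj H)x̂|² = |H|²`, so for `ε ≥ 1` the quadratic part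
is at least `ε⁻¹|H|²`. The trace integrates to zero because `u` vanishes on the boundary.

Everything rests on the bound `∫ x̂·Hx̂ ≤ ½ ∫ |H|²` (`IsGradientLimit.integral_radialForm_le`).
Since `∑ⱼ ∂ⱼ(xᵢxⱼ/|x|²) = ∂ᵢ log|x|`, integration by parts turns the left side into `∫ log|x| div
u`. The constraint `det(1 + H) = 1` says `tr H = -det H`, so this equals `-½ ∫ log|x|² det H`. The
determinant is a null Lagrangian; a further integration by parts yields `∫ u₀ ∂_θ u₁ / |x|²`. On
each circle the isoperimetric inequality, a consequence of Wirtinger's, bounds this by half of `∫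
|∂_θ u|² / |x|²`, hence by `½ ∫ |H|²`.

The energy excess is therefore at least `(2ε⁻¹ - ε) ∫ |H|²`, whose coefficient is nonnegative
exactly when `ε² ≤ 2`. For `ε² < 2` a minimizer has `H = 0`, and Poincaré's inequality gives `u =
0`.

The weights are singular at the origin, so `|x|²` is replaced by `|x|² + δ²`. For fixed `δ` the
estimates pass from test functions to `u`; only then is the determinant constraint, which the
approximants need not satisfy, applied, and finally `δ → 0`. -/

namespace Buckling

/-! ### Wirtinger and isoperimetric inequalities on the circle -/

/-- **Wirtinger's inequality** on the circle. -/
theorem wirtinger_inequality {f f' : ℝ → ℝ} (hf : ∀ t, HasDerivAt f (f' t) t)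
    (hf' : Continuous f') (hper : f (2 * Real.pi) = f 0)
    (hmean : ∫ t in (0 : ℝ)..(2 * Real.pi), f t = 0) :
    ∫ t in (0 : ℝ)..(2 * Real.pi), f t ^ 2 ≤ ∫ t in (0 : ℝ)..(2 * Real.pi), f' t ^ 2 := by
  have hab : (0 : ℝ) < 2 * Real.pi := by positivity
  have hfc : Continuous f := continuous_iff_continuousAt.2 fun t => (hf t).continuousAt
  have memLp_coe : ∀ g : ℝ → ℝ, Continuous g →
      MemLp (fun t => (g t : ℂ)) 2 (volume.restrict (Set.Ioc 0 (2 * Real.pi))) := by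
    intro g hg
    have h1 : ContinuousOn (fun t => (g t : ℂ)) (Set.Icc 0 (2 * Real.pi)) :=
      (Complex.continuous_ofReal.comp hg).continuousOn
    obtain ⟨C, hC⟩ := isCompact_Icc.exists_bound_of_continuousOn h1
    refine MemLp.of_bound (Complex.continuous_ofReal.comp hg).aestronglyMeasurable C ?_
    rw [ae_restrict_iff' measurableSet_Ioc]
    exact ae_of_all _ fun t ht => hC t (Set.Ioc_subset_Icc_self ht)
  have s1 := hasSum_sq_fourierCoeffOn hab (memLp_coe f hfc)
  have s2 := hasSum_sq_fourierCoeffOn hab (memLp_coe f' hf')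
  have key : ∀ n : ℤ, ‖fourierCoeffOn hab (fun t => (f t : ℂ)) n‖ ^ 2 ≤
      ‖fourierCoeffOn hab (fun t => (f' t : ℂ)) n‖ ^ 2 := by
    intro n
    rcases eq_or_ne n 0 with rfl | hn
    -- The zeroth coefficient of `f` is its mean, which vanishes.
    · rw [fourierCoeffOn_eq_integral]
      simp only [neg_zero, fourier_zero, one_smul]
      rw [intervalIntegral.integral_ofReal, hmean]
      simp
    -- By periodicity the boundary term drops out, leaving `|cₙ(f)| = |cₙ(f')| / |n|` with `|n| ≥
    -- 1`.
    · rw [fourierCoeffOn_of_hasDerivAt (f' := fun t => (f' t : ℂ)) hab hn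
        (fun t _ => (hf t).ofReal_comp)
        ((Complex.continuous_ofReal.comp hf').intervalIntegrable _ _)]
      rw [hper, sub_self, mul_zero, zero_sub]
      have h1 : (1 : ℝ) ≤ |(n : ℝ)| := by
        exact_mod_cast Int.one_le_abs hn
      have hpi : (0 : ℝ) < Real.pi := Real.pi_pos
      rw [norm_mul, norm_neg, norm_mul]
      have e : ‖(1 : ℂ) / (-2 * Real.pi * Complex.I * n)‖ = 1 / (2 * Real.pi * |(n : ℝ)|) := by
        simp [abs_of_pos hpi]
      have e' : ‖(((2 * Real.pi : ℝ) : ℂ) - ((0 : ℝ) : ℂ))‖ = 2 * Real.pi := by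
        rw [Complex.ofReal_zero, sub_zero, Complex.norm_real, Real.norm_of_nonneg hab.le]
      rw [e, e']
      refine pow_le_pow_left₀ (by positivity) ?_ 2
      rw [← mul_assoc]
      refine mul_le_of_le_one_left (norm_nonneg _) ?_
      rw [one_div_mul_eq_div, div_le_one (by positivity)]
      exact le_mul_of_one_le_right hab.le h1
  have := hasSum_le key s1 s2
  simp only [Complex.norm_real, Real.norm_eq_abs, sq_abs, smul_eq_mul, sub_zero] at this
  exact le_of_mul_le_mul_left this (inv_pos.2 hab)

/-- The isoperimetric inequality for closed curves `(f, g)`, in integral form. -/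
theorem two_mul_integral_mul_deriv_le {f f' g g' : ℝ → ℝ} (hf : ∀ t, HasDerivAt f (f' t) t)
    (hf' : Continuous f') (hfper : f (2 * Real.pi) = f 0) (hg : ∀ t, HasDerivAt g (g' t) t)
    (hg' : Continuous g') (hgper : g (2 * Real.pi) = g 0) :
    0 ≤ ∫ t in (0 : ℝ)..(2 * Real.pi), (f' t ^ 2 + g' t ^ 2 - 2 * (f t * g' t)) := by
  have hab : (0 : ℝ) < 2 * Real.pi := by positivity
  have hfc : Continuous f := continuous_iff_continuousAt.2 fun t => (hf t).continuousAt
  set m : ℝ := (2 * Real.pi)⁻¹ * ∫ t in (0 : ℝ)..(2 * Real.pi), f t with hm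
  have hW := wirtinger_inequality (f := fun t => f t - m) (f' := f')
    (fun t => (hf t).sub_const m) hf' (by simp [hfper]) (by
      rw [intervalIntegral.integral_sub (hfc.intervalIntegrable _ _) (by simp)]
      simp only [intervalIntegral.integral_const, smul_eq_mul, sub_zero, hm]
      rw [mul_inv_cancel_left₀ hab.ne', sub_self])
  have h0 : ∫ t in (0 : ℝ)..(2 * Real.pi), g' t = 0 := by
    rw [intervalIntegral.integral_eq_sub_of_hasDerivAt (fun t _ => hg t)
      (hg'.intervalIntegrable _ _), hgper, sub_self]
  have hsq : 0 ≤ ∫ t in (0 : ℝ)..(2 * Real.pi), ((f t - m) - g' t) ^ 2 :=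
    intervalIntegral.integral_nonneg hab.le fun t _ => sq_nonneg _
  -- Completing the square around the mean `m` of `f`; subtracting `m` costs nothing because `g'`
  -- has zero mean.
  have e : ∫ t in (0 : ℝ)..(2 * Real.pi), (f' t ^ 2 + g' t ^ 2 - 2 * (f t * g' t)) =
      (∫ t in (0 : ℝ)..(2 * Real.pi), f' t ^ 2) - (∫ t in (0 : ℝ)..(2 * Real.pi), (f t - m) ^ 2)
        + (∫ t in (0 : ℝ)..(2 * Real.pi), ((f t - m) - g' t) ^ 2)
        - 2 * m * ∫ t in (0 : ℝ)..(2 * Real.pi), g' t := by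
    rw [← intervalIntegral.integral_const_mul, ← intervalIntegral.integral_sub,
      ← intervalIntegral.integral_add, ← intervalIntegral.integral_sub]
    · congr 1; ext t; ring
    all_goals exact Continuous.intervalIntegrable (by fun_prop) _ _
  rw [e, h0]
  linarith

/-! ### Rotations and circular means -/

/-- The rotation of the plane by the angle `t`. -/
noncomputable def rotate (t : ℝ) (x : Plane) : Plane :=
  !₂[Real.cos t * x 0 - Real.sin t * x 1, Real.sin t * x 0 + Real.cos t * x 1]

@[simp] theorem rotate_zero_apply (t : ℝ) (x : Plane) :
    rotate t x 0 = Real.cos t * x 0 - Real.sin t * x 1 := rfl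

@[simp] theorem rotate_one_apply (t : ℝ) (x : Plane) :
    rotate t x 1 = Real.sin t * x 0 + Real.cos t * x 1 := rfl

theorem norm_sq_eq (x : Plane) : ‖x‖ ^ 2 = x 0 ^ 2 + x 1 ^ 2 := by
  simp [EuclideanSpace.norm_sq_eq, Fin.sum_univ_two]

theorem norm_rotate (t : ℝ) (x : Plane) : ‖rotate t x‖ = ‖x‖ := by
  rw [← sq_eq_sq₀ (norm_nonneg _) (norm_nonneg _), norm_sq_eq, norm_sq_eq]
  simp only [rotate_zero_apply, rotate_one_apply]
  linear_combination (x 0 ^ 2 + x 1 ^ 2) * Real.sin_sq_add_cos_sq t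

/-- Rotations as linear isometries. -/
noncomputable def rotateₗᵢ (t : ℝ) : Plane →ₗᵢ[ℝ] Plane where
  toFun := rotate t
  map_add' x y := by
    ext i; fin_cases i <;> simp <;> ring
  map_smul' c x := by
    ext i; fin_cases i <;> simp <;> ring
  norm_map' := norm_rotate t

theorem measurePreserving_rotate (t : ℝ) : MeasurePreserving (rotate t) volume volume :=
  ((rotateₗᵢ t).toLinearIsometryEquiv rfl).measurePreserving

theorem measurableEmbedding_rotate (t : ℝ) : MeasurableEmbedding (rotate t) :=
  ((rotateₗᵢ t).toLinearIsometryEquiv rfl).toHomeomorph.measurableEmbedding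

theorem continuous_rotate : Continuous fun p : ℝ × Plane => rotate p.1 p.2 := by
  refine (PiLp.continuous_toLp 2 _).comp (continuous_pi fun i => ?_)
  fin_cases i <;> simp <;> fun_prop

theorem continuous_rotate_angle (x : Plane) : Continuous fun t => rotate t x := by
  refine (PiLp.continuous_toLp 2 _).comp (continuous_pi fun i => ?_)
  fin_cases i <;> simp <;> fun_prop

/-- A continuous function with nonnegative circular means has a nonnegative integral. -/
theorem integral_nonneg_of_circular_means {F : Plane → ℝ} (hF : Continuous F)
    (hmean : ∀ x, 0 ≤ ∫ t in (0 : ℝ)..(2 * Real.pi), F (rotate t x)) :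
    0 ≤ ∫ x in disc, F x := by
  have hab : (0 : ℝ) < 2 * Real.pi := by positivity
  have rot : ∀ t, ∫ x in disc, F (rotate t x) =
      ∫ x in disc, F x := by
    intro t
    have h := (measurePreserving_rotate t).setIntegral_preimage_emb
      (measurableEmbedding_rotate t) F disc
    rw [← h]
    congr 2
    ext x
    simp [norm_rotate]
  have hint : Integrable (Function.uncurry fun (t : ℝ) x => F (rotate t x))
      ((volume.restrict (Set.Ioc 0 (2 * Real.pi))).prod
        (volume.restrict (disc))) := by
    rw [Measure.prod_restrict]
    have h1 : IntegrableOn (Function.uncurry fun (t : ℝ) x => F (rotate t x))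
        (Set.Icc 0 (2 * Real.pi) ×ˢ Metric.closedBall (0 : Plane) 1)
        ((volume : Measure ℝ).prod volume) :=
      (hF.comp continuous_rotate).continuousOn.integrableOn_compact
        (isCompact_Icc.prod (isCompact_closedBall _ _))
    exact h1.mono_set (Set.prod_mono Set.Ioc_subset_Icc_self Metric.ball_subset_closedBall)
  -- Averaging over rotations and Fubini take the place of polar coordinates.
  have h2 : ∫ t in Set.Ioc 0 (2 * Real.pi), ∫ x in disc,
      F (rotate t x) = 2 * Real.pi * ∫ x in disc, F x := by
    simp_rw [rot]
    rw [setIntegral_const, smul_eq_mul, measureReal_def, Real.volume_Ioc, sub_zero,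
      ENNReal.toReal_ofReal hab.le]
  rw [integral_integral_swap hint] at h2
  have h3 : 0 ≤ ∫ x in disc, ∫ t in Set.Ioc 0 (2 * Real.pi),
      F (rotate t x) := by
    refine integral_nonneg fun x => ?_
    rw [← intervalIntegral.integral_of_le hab.le]
    exact hmean x
  rw [h2] at h3
  exact nonneg_of_mul_nonneg_right h3 hab

/-! ### Calculus of partial derivatives -/

section PartialDerivatives

theorem partialDeriv_eq_of_hasFDerivAt {j : Fin 2} {u : Plane → ℝ} {x : Plane}
    {u' : Plane →L[ℝ] ℝ} (h : HasFDerivAt u u' x) :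
    partialDeriv j u x = u' (EuclideanSpace.single j 1) := by
  rw [partialDeriv, h.fderiv]

theorem hasFDerivAt_coord (i : Fin 2) (x : Plane) :
    HasFDerivAt (fun y : Plane => y i) (EuclideanSpace.proj i : Plane →L[ℝ] ℝ) x :=
  (EuclideanSpace.proj i : Plane →L[ℝ] ℝ).hasFDerivAt

theorem contDiff_coord (i : Fin 2) {n : WithTop ℕ∞} : ContDiff ℝ n (fun y : Plane => y i) :=
  (EuclideanSpace.proj i : Plane →L[ℝ] ℝ).contDiff

theorem contDiff_partialDeriv {F : Type*} [NormedAddCommGroup F] [NormedSpace ℝ F]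
    {φ : Plane → F} {m n : WithTop ℕ∞} (hφ : ContDiff ℝ n φ) (h : m + 1 ≤ n) (j : Fin 2) :
    ContDiff ℝ m (partialDeriv j φ) :=
  (hφ.fderiv_right h).clm_apply contDiff_const

theorem partialDeriv_mul {u v : Plane → ℝ} {x : Plane} (hu : DifferentiableAt ℝ u x)
    (hv : DifferentiableAt ℝ v x) (j : Fin 2) :
    partialDeriv j (fun y => u y * v y) x
      = u x * partialDeriv j v x + v x * partialDeriv j u x := by
  rw [partialDeriv_eq_of_hasFDerivAt (u := fun y => u y * v y)
    (hu.hasFDerivAt.mul hv.hasFDerivAt)]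
  simp [partialDeriv]

theorem partialDeriv_comm {u : Plane → ℝ} (hu : ContDiff ℝ 2 u) (x : Plane) :
    partialDeriv 0 (partialDeriv 1 u) x = partialDeriv 1 (partialDeriv 0 u) x := by
  have hd : DifferentiableAt ℝ (fderiv ℝ u) x :=
    ((hu.fderiv_right (m := 1) (by norm_num)).differentiable (by norm_num)) x
  have key : ∀ i j, partialDeriv i (partialDeriv j u) x =
      fderiv ℝ (fderiv ℝ u) x (EuclideanSpace.single i 1) (EuclideanSpace.single j 1) := by
    intro i j
    have : HasFDerivAt (partialDeriv j u) ((fderiv ℝ (fderiv ℝ u) x).flip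
        (EuclideanSpace.single j 1)) x := by
      have h := hd.hasFDerivAt.clm_apply (hasFDerivAt_const (EuclideanSpace.single j (1 : ℝ)) x)
      rw [ContinuousLinearMap.comp_zero, zero_add] at h
      exact h
    rw [partialDeriv_eq_of_hasFDerivAt this]
    rfl
  rw [key, key]
  exact (hu.contDiffAt.isSymmSndFDerivAt (by simp)).eq _ _

theorem partialDeriv_apply {φ : Plane → Plane} {x : Plane} (h : DifferentiableAt ℝ φ x)
    (i j : Fin 2) : partialDeriv j (fun y => φ y i) x = partialDeriv j φ x i :=
  partialDeriv_eq_of_hasFDerivAt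
    ((EuclideanSpace.proj i : Plane →L[ℝ] ℝ).hasFDerivAt.comp x h.hasFDerivAt)

end PartialDerivatives

/-! ### Test functions, integration by parts and Poincaré's inequality -/

section TestFunctions

theorem IsTestFunction.apply {φ : Plane → Plane} (hφ : IsTestFunction φ) (i : Fin 2) :
    IsTestFunction (fun x => φ x i) where
  contDiff := (EuclideanSpace.proj i : Plane →L[ℝ] ℝ).contDiff.comp hφ.contDiff
  hasCompactSupport := hφ.hasCompactSupport.comp_left (g := fun y : Plane => y i) rfl
  tsupport_subset := (tsupport_comp_subset (g := fun y : Plane => y i) rfl φ).trans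
    hφ.tsupport_subset

variable {f g : Plane → ℝ}

theorem IsTestFunction.differentiable (hf : IsTestFunction f) : Differentiable ℝ f :=
  hf.contDiff.differentiable (by simp)

theorem IsTestFunction.contDiff_partialDeriv (hf : IsTestFunction f) (j : Fin 2) :
    ContDiff ℝ ∞ (partialDeriv j f) :=
  Buckling.contDiff_partialDeriv hf.contDiff (by simp) j

theorem IsTestFunction.partialDeriv (hf : IsTestFunction f) (j : Fin 2) :
    IsTestFunction (partialDeriv j f) where
  contDiff := hf.contDiff_partialDeriv j
  hasCompactSupport := hf.hasCompactSupport.fderiv_apply (𝕜 := ℝ) _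
  tsupport_subset := (closure_mono fun x hx => by
    by_contra h
    refine hx ?_
    have := support_fderiv_subset ℝ (f := f)
    have h0 : fderiv ℝ f x = 0 := by
      by_contra h1
      exact h (this h1)
    simp [Buckling.partialDeriv, h0]).trans (closure_minimal subset_rfl isClosed_closure
      |>.trans hf.tsupport_subset)

theorem IsTestFunction.eq_zero (hf : IsTestFunction f) {x : Plane} (hx : x ∉ disc) : f x = 0 :=
  image_eq_zero_of_notMem_tsupport fun h => hx (hf.tsupport_subset h)

theorem IsTestFunction.mul {u : Plane → ℝ} (hu : ContDiff ℝ ∞ u) (hf : IsTestFunction f) :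
    IsTestFunction (fun x => u x * f x) where
  contDiff := hu.mul hf.contDiff
  hasCompactSupport := hf.hasCompactSupport.mul_left
  tsupport_subset := (tsupport_mul_subset_right (f := u) (g := f)).trans hf.tsupport_subset

theorem IsTestFunction.integrable (hf : IsTestFunction f) : Integrable f discMeasure :=
  (hf.contDiff.continuous.integrable_of_hasCompactSupport hf.hasCompactSupport).restrict

theorem IsTestFunction.setIntegral_eq (hf : IsTestFunction f) :
    ∫ x in disc, f x = ∫ x, f x :=
  setIntegral_eq_integral_of_forall_compl_eq_zero fun _ hx => hf.eq_zero hx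

theorem IsTestFunction.memLp (hf : IsTestFunction f) : MemLp f 2 discMeasure :=
  (hf.contDiff.continuous.memLp_of_hasCompactSupport hf.hasCompactSupport).restrict _

/-- Integration by parts against a test function. -/
theorem IsTestFunction.integral_mul_partialDeriv (hf : IsTestFunction f) {u : Plane → ℝ}
    (hu : ContDiff ℝ ∞ u) (j : Fin 2) :
    ∫ x in disc, u x * Buckling.partialDeriv j f x =
      - ∫ x in disc, Buckling.partialDeriv j u x * f x := by
  have hu' : ContDiff ℝ ∞ (Buckling.partialDeriv j u) :=
    Buckling.contDiff_partialDeriv hu (by simp) j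
  rw [((hf.partialDeriv j).mul hu).setIntegral_eq, (hf.mul hu').setIntegral_eq]
  have cpt : ∀ {h : Plane → ℝ}, IsTestFunction h → Integrable h := fun h =>
    h.contDiff.continuous.integrable_of_hasCompactSupport h.hasCompactSupport
  exact integral_mul_fderiv_eq_neg_fderiv_mul_of_integrable (cpt (hf.mul hu'))
    (cpt ((hf.partialDeriv j).mul hu)) (cpt (hf.mul hu))
    (fun x _ => hu.differentiable (by simp) x) (fun x _ => hf.differentiable x)

theorem IsTestFunction.integral_partialDeriv (hf : IsTestFunction f) (j : Fin 2) :
    ∫ x in disc, Buckling.partialDeriv j f x = 0 := by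
  have := hf.integral_mul_partialDeriv (u := fun _ => 1) contDiff_const j
  simpa [Buckling.partialDeriv] using this

/-- The Poincaré inequality for test functions. -/
theorem IsTestFunction.integral_sq_le (hf : IsTestFunction f) :
    ∫ x in disc, f x ^ 2 ≤ 4 * ∫ x in disc, Buckling.partialDeriv 0 f x ^ 2 := by
  -- Since `∂₀x₀ = 1`, this reads `∫ f² = -∫ x₀ ∂₀(f²)`.
  have h1 := (hf.mul hf.contDiff).integral_mul_partialDeriv (contDiff_coord 0) 0
  have hc : ∀ x : Plane, Buckling.partialDeriv 0 (fun y : Plane => y 0) x = 1 := fun x => by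
    rw [partialDeriv_eq_of_hasFDerivAt (hasFDerivAt_coord 0 x)]; simp
  simp only [hc, one_mul] at h1
  have hd := hf.partialDeriv 0
  have i1 : Integrable (fun x => f x * f x) discMeasure := (hf.mul hf.contDiff).integrable
  have i2 : Integrable (fun x => Buckling.partialDeriv 0 f x * Buckling.partialDeriv 0 f x)
    discMeasure := (hd.mul hd.contDiff).integrable
  have h2 : ∫ x in disc, (-(x 0 * Buckling.partialDeriv 0 (fun y => f y * f y) x)) ≤
      ∫ x in disc, (1 / 2 * (f x * f x) +
        2 * (Buckling.partialDeriv 0 f x * Buckling.partialDeriv 0 f x)) := by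
    refine setIntegral_mono_on ?_ ((i1.const_mul _).add (i2.const_mul _)) measurableSet_ball ?_
    · exact ((((hf.mul hf.contDiff).partialDeriv 0).mul (contDiff_coord 0)).integrable).neg
    · intro x hx
      rw [partialDeriv_mul (hf.differentiable x) (hf.differentiable x)]
      have hx0 : x 0 ^ 2 ≤ 1 := by
        have : ‖x‖ < 1 := by simpa using hx
        have h := norm_sq_eq x
        nlinarith [sq_nonneg (x 1), norm_nonneg x]
      -- Young's inequality with weight ½ on `f²`, so that this term can be absorbed on the left;
      -- this produces the constant 4.
      nlinarith [sq_nonneg (f x + 2 * (x 0 * Buckling.partialDeriv 0 f x)),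
        mul_le_mul_of_nonneg_right hx0 (sq_nonneg (Buckling.partialDeriv 0 f x))]
  rw [integral_neg, integral_add (i1.const_mul _) (i2.const_mul _), integral_const_mul,
    integral_const_mul] at h2
  simp only [pow_two]
  linarith

end TestFunctions

/-! ### Regularised weights -/

section Weights

/-- The regularised squared distance `|x|² + δ²` to the origin. -/
noncomputable def regSq (δ : ℝ) (x : Plane) : ℝ := x 0 ^ 2 + x 1 ^ 2 + δ ^ 2

variable {δ : ℝ}

theorem regSq_pos (hδ : 0 < δ) (x : Plane) : 0 < regSq δ x := by
  unfold regSq; positivity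

theorem contDiff_regSq {n : WithTop ℕ∞} : ContDiff ℝ n (regSq δ) :=
  (((contDiff_coord 0).pow 2).add ((contDiff_coord 1).pow 2)).add contDiff_const

theorem partialDeriv_coord (i j : Fin 2) (x : Plane) :
    partialDeriv j (fun y : Plane => y i) x = if i = j then 1 else 0 := by
  rw [partialDeriv_eq_of_hasFDerivAt (hasFDerivAt_coord i x)]
  simp

theorem partialDeriv_regSq (j : Fin 2) (x : Plane) : partialDeriv j (regSq δ) x = 2 * x j := by
  have h := (((hasFDerivAt_coord 0 x).pow 2).add ((hasFDerivAt_coord 1 x).pow 2)).add_const (δ ^ 2)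
  rw [partialDeriv_eq_of_hasFDerivAt (u := regSq δ) h]
  fin_cases j <;> simp

theorem partialDeriv_log_regSq (hδ : 0 < δ) (j : Fin 2) (x : Plane) :
    partialDeriv j (fun y => Real.log (regSq δ y)) x = 2 * x j / regSq δ x := by
  have h : HasFDerivAt (regSq δ) (fderiv ℝ (regSq δ) x) x :=
    (contDiff_regSq.differentiable (n := 1) (by norm_num) x).hasFDerivAt
  rw [partialDeriv_eq_of_hasFDerivAt (h.log (regSq_pos hδ x).ne')]
  have := partialDeriv_regSq (δ := δ) j x
  rw [partialDeriv] at this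
  simp [this]
  ring

theorem partialDeriv_inv_regSq (hδ : 0 < δ) (j : Fin 2) (x : Plane) :
    partialDeriv j (fun y => (regSq δ y)⁻¹) x = -(2 * x j) / regSq δ x ^ 2 := by
  have h : HasFDerivAt (regSq δ) (fderiv ℝ (regSq δ) x) x :=
    (contDiff_regSq.differentiable (n := 1) (by norm_num) x).hasFDerivAt
  rw [partialDeriv_eq_of_hasFDerivAt (u := fun y => (regSq δ y)⁻¹)
    ((hasDerivAt_inv (regSq_pos hδ x).ne').comp_hasFDerivAt x h)]
  have := partialDeriv_regSq (δ := δ) j x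
  rw [partialDeriv] at this
  simp [this]
  ring

theorem contDiff_log_regSq (hδ : 0 < δ) : ContDiff ℝ ∞ (fun x => Real.log (regSq δ x)) :=
  contDiff_regSq.log fun x => (regSq_pos hδ x).ne'

theorem contDiff_inv_regSq (hδ : 0 < δ) : ContDiff ℝ ∞ (fun x => (regSq δ x)⁻¹) :=
  contDiff_regSq.inv fun x => (regSq_pos hδ x).ne'

end Weights

/-! ### Weighted identities and inequalities for test functions -/

section TestIdentities

variable {f g : Plane → ℝ} {δ : ℝ}

/-- With `s = |x|² + δ²`, both sides equal `xᵢ/s + 2δ²xᵢ/s²`. That the divergence is a gradient is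
what allows the radial form to be exchanged for the divergence of `u`. -/
theorem partialDeriv_sum_weight (hδ : 0 < δ) (i : Fin 2) (x : Plane) :
    partialDeriv 0 (fun y : Plane => (y i * y 0) * (regSq δ y)⁻¹) x +
      partialDeriv 1 (fun y : Plane => (y i * y 1) * (regSq δ y)⁻¹) x =
    partialDeriv i (fun y => 2⁻¹ * Real.log (regSq δ y) - δ ^ 2 * (regSq δ y)⁻¹) x := by
  have dc : ∀ k : Fin 2, DifferentiableAt ℝ (fun y : Plane => y k) x := fun k =>
    (hasFDerivAt_coord k x).differentiableAt
  have ds : DifferentiableAt ℝ (fun y => (regSq δ y)⁻¹) x :=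
    (contDiff_inv_regSq hδ).differentiable (by simp) x
  have dl : DifferentiableAt ℝ (fun y => Real.log (regSq δ y)) x :=
    (contDiff_log_regSq hδ).differentiable (by simp) x
  have e : partialDeriv i (fun y => 2⁻¹ * Real.log (regSq δ y) - δ ^ 2 * (regSq δ y)⁻¹) x =
      2⁻¹ * partialDeriv i (fun y => Real.log (regSq δ y)) x -
        δ ^ 2 * partialDeriv i (fun y => (regSq δ y)⁻¹) x := by
    rw [partialDeriv_eq_of_hasFDerivAt
      (u := fun y => 2⁻¹ * Real.log (regSq δ y) - δ ^ 2 * (regSq δ y)⁻¹)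
      ((dl.hasFDerivAt.const_mul 2⁻¹).sub (ds.hasFDerivAt.const_mul (δ ^ 2)))]
    simp [partialDeriv]
  rw [e, partialDeriv_mul (u := fun y : Plane => y i * y 0) ((dc i).mul (dc 0)) ds,
    partialDeriv_mul (u := fun y : Plane => y i * y 1) ((dc i).mul (dc 1)) ds,
    partialDeriv_mul (dc i) (dc 0), partialDeriv_mul (dc i) (dc 1), partialDeriv_log_regSq hδ,
    partialDeriv_inv_regSq hδ, partialDeriv_inv_regSq hδ, partialDeriv_inv_regSq hδ]
  simp only [partialDeriv_coord]
  have hs : regSq δ x ≠ 0 := (regSq_pos hδ x).ne'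
  have hd : δ ^ 2 = regSq δ x - x 0 ^ 2 - x 1 ^ 2 := by unfold regSq; ring
  rw [hd]
  fin_cases i <;> simp <;> field_simp <;> ring

/-- Integrate by parts to put the derivatives on the weights, apply `partialDeriv_sum_weight`, and
integrate by parts back. -/
theorem IsTestFunction.integral_weight_mul_partialDeriv (hf : IsTestFunction f) (hδ : 0 < δ)
    (i : Fin 2) :
    (∫ x in disc, ((x i * x 0) * (regSq δ x)⁻¹) * Buckling.partialDeriv 0 f x) +
      ∫ x in disc, ((x i * x 1) * (regSq δ x)⁻¹) * Buckling.partialDeriv 1 f x =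
    ∫ x in disc, (2⁻¹ * Real.log (regSq δ x) - δ ^ 2 * (regSq δ x)⁻¹) *
      Buckling.partialDeriv i f x := by
  have hw : ∀ j : Fin 2, ContDiff ℝ ∞ (fun y : Plane => (y i * y j) * (regSq δ y)⁻¹) := fun j =>
    ((contDiff_coord i).mul (contDiff_coord j)).mul (contDiff_inv_regSq hδ)
  have hl : ContDiff ℝ ∞ (fun y => 2⁻¹ * Real.log (regSq δ y) - δ ^ 2 * (regSq δ y)⁻¹) :=
    (contDiff_const.mul (contDiff_log_regSq hδ)).sub (contDiff_const.mul (contDiff_inv_regSq hδ))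
  rw [hf.integral_mul_partialDeriv (hw 0), hf.integral_mul_partialDeriv (hw 1),
    hf.integral_mul_partialDeriv hl, ← neg_add, ← integral_add]
  · congr 2
    ext x
    rw [← add_mul, partialDeriv_sum_weight hδ]
  · exact (hf.mul (Buckling.contDiff_partialDeriv (hw 0) (by simp) 0)).integrable
  · exact (hf.mul (Buckling.contDiff_partialDeriv (hw 1) (by simp) 1)).integrable

/-- The angular derivative `x₀ ∂₁ f - x₁ ∂₀ f`. -/
noncomputable def angularDeriv (f : Plane → ℝ) (x : Plane) : ℝ :=
  x 0 * partialDeriv 1 f x - x 1 * partialDeriv 0 f x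

theorem hasDerivAt_comp_rotate (hf : Differentiable ℝ f) (x : Plane) (t : ℝ) :
    HasDerivAt (fun t => f (rotate t x)) (angularDeriv f (rotate t x)) t := by
  have hr : HasDerivAt (fun t => rotate t x)
      (-Real.sin t • x + Real.cos t • (!₂[-x 1, x 0] : Plane)) t := by
    have e : (fun t => rotate t x) =
        fun t => Real.cos t • x + Real.sin t • (!₂[-x 1, x 0] : Plane) := by
      ext t i; fin_cases i <;> simp <;> ring
    rw [e]
    exact ((Real.hasDerivAt_cos t).smul_const x).add ((Real.hasDerivAt_sin t).smul_const _)
  have h := (hf (rotate t x)).hasFDerivAt.comp_hasDerivAt t hr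
  have e : -Real.sin t • x + Real.cos t • (!₂[-x 1, x 0] : Plane) =
      (-(rotate t x 1)) • EuclideanSpace.single 0 1 +
        (rotate t x 0) • EuclideanSpace.single 1 1 := by
    ext i; fin_cases i <;> simp <;> ring
  rw [e, map_add, map_smul, map_smul] at h
  refine h.congr_deriv ?_
  simp only [angularDeriv, partialDeriv, smul_eq_mul]
  ring

theorem regSq_rotate (t : ℝ) (x : Plane) : regSq δ (rotate t x) = regSq δ x := by
  unfold regSq
  rw [← norm_sq_eq, ← norm_sq_eq, norm_rotate]

theorem continuous_angularDeriv (hf : ContDiff ℝ ∞ f) : Continuous (angularDeriv f) := by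
  have h := fun j => (contDiff_partialDeriv (m := ∞) hf (by simp) j).continuous
  have h0 := fun i => (contDiff_coord i (n := 0)).continuous
  exact ((h0 0).mul (h 1)).sub ((h0 1).mul (h 0))

/-- The weight is constant on circles about the origin, so the isoperimetric inequality for the
closed curve `t ↦ (f, g)(rotate t x)` applies circle by circle. -/
theorem IsTestFunction.two_mul_integral_angularDeriv_le (hf : IsTestFunction f)
    (hg : IsTestFunction g) (hδ : 0 < δ) :
    0 ≤ ∫ x in disc, (regSq δ x)⁻¹ *
      (angularDeriv f x ^ 2 + angularDeriv g x ^ 2 - 2 * (f x * angularDeriv g x)) := by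
  have cf := hf.contDiff.continuous
  have af := continuous_angularDeriv hf.contDiff
  have ag := continuous_angularDeriv hg.contDiff
  have cs := (contDiff_inv_regSq hδ).continuous
  have hc : Continuous fun x => (regSq δ x)⁻¹ *
      (angularDeriv f x ^ 2 + angularDeriv g x ^ 2 - 2 * (f x * angularDeriv g x)) :=
    cs.mul (((af.pow 2).add (ag.pow 2)).sub (continuous_const.mul (cf.mul ag)))
  refine integral_nonneg_of_circular_means hc fun x => ?_
  simp only [regSq_rotate]
  rw [intervalIntegral.integral_const_mul]
  have hr := continuous_rotate_angle x
  refine mul_nonneg (inv_pos.2 (regSq_pos hδ x)).le ?_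
  have hp : rotate (2 * Real.pi) x = rotate 0 x := by
    ext i; fin_cases i <;> simp
  exact two_mul_integral_mul_deriv_le (fun t => hasDerivAt_comp_rotate hf.differentiable x t)
    (af.comp hr) (by rw [hp]) (fun t => hasDerivAt_comp_rotate hg.differentiable x t)
    (ag.comp hr) (by rw [hp])

/-- The Jacobian determinant is a null Lagrangian: its integral against a logarithmic weight can
be computed by parts. -/
theorem IsTestFunction.integral_log_mul_det (hf : IsTestFunction f) (hg : IsTestFunction g)
    (hδ : 0 < δ) :
    ∫ x in disc, Real.log (regSq δ x) * (Buckling.partialDeriv 0 f x * Buckling.partialDeriv 1 g x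
        - Buckling.partialDeriv 1 f x * Buckling.partialDeriv 0 g x) =
      - ∫ x in disc, (regSq δ x)⁻¹ * (2 * (f x * angularDeriv g x)) := by
  have hl := contDiff_log_regSq hδ
  have hL : ∀ j, ContDiff ℝ ∞ fun x => Real.log (regSq δ x) * Buckling.partialDeriv j g x :=
    fun j => hl.mul (hg.contDiff_partialDeriv j)
  have h0 := hf.integral_mul_partialDeriv (hL 1) 0
  have h1 := hf.integral_mul_partialDeriv (hL 0) 1
  have e1 : ∫ x in disc, Real.log (regSq δ x) *
      (Buckling.partialDeriv 0 f x * Buckling.partialDeriv 1 g x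
        - Buckling.partialDeriv 1 f x * Buckling.partialDeriv 0 g x) =
      (∫ x in disc, (Real.log (regSq δ x) * Buckling.partialDeriv 1 g x) *
        Buckling.partialDeriv 0 f x) -
      ∫ x in disc, (Real.log (regSq δ x) * Buckling.partialDeriv 0 g x) *
        Buckling.partialDeriv 1 f x := by
    rw [← integral_sub ((hf.partialDeriv 0).mul (hL 1)).integrable
      ((hf.partialDeriv 1).mul (hL 0)).integrable]
    congr 1; ext x; ring
  have hD : ∀ i j, ContDiff ℝ ∞ (Buckling.partialDeriv i fun x =>
      Real.log (regSq δ x) * Buckling.partialDeriv j g x) :=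
    fun i j => Buckling.contDiff_partialDeriv (hL j) (by simp) i
  rw [e1, h0, h1, neg_sub_neg, ← neg_sub, ← integral_sub (hf.mul (hD 0 1)).integrable
    (hf.mul (hD 1 0)).integrable]
  congr 2
  ext x
  have dl : DifferentiableAt ℝ (fun y => Real.log (regSq δ y)) x := hl.differentiable (by simp) x
  have dg : ∀ j, DifferentiableAt ℝ (Buckling.partialDeriv j g) x := fun j =>
    (hg.contDiff_partialDeriv j).differentiable (by simp) x
  -- The mixed second derivatives of `g` cancel; only the gradient of the logarithm survives, and it
  -- is radial, which produces the angular derivative.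
  rw [partialDeriv_mul dl (dg 1), partialDeriv_mul dl (dg 0), partialDeriv_log_regSq hδ,
    partialDeriv_log_regSq hδ, partialDeriv_comm (contDiff_infty.1 hg.contDiff 2),
    angularDeriv]
  ring

/-- Combines the null Lagrangian identity, the isoperimetric inequality on circles and the pointwise
bound of the angular derivative by `|x|` times the gradient. -/
theorem IsTestFunction.neg_integral_log_mul_det_le (hf : IsTestFunction f)
    (hg : IsTestFunction g) (hδ : 0 < δ) :
    - ∫ x in disc, Real.log (regSq δ x) *
        (Buckling.partialDeriv 0 f x * Buckling.partialDeriv 1 g x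
          - Buckling.partialDeriv 1 f x * Buckling.partialDeriv 0 g x) ≤
      ∫ x in disc, (Buckling.partialDeriv 0 f x ^ 2 + Buckling.partialDeriv 1 f x ^ 2 +
        Buckling.partialDeriv 0 g x ^ 2 + Buckling.partialDeriv 1 g x ^ 2) := by
  have hcont : ∀ u : Plane → ℝ, Continuous u → IntegrableOn u disc := fun u hu =>
    (hu.continuousOn.integrableOn_compact (isCompact_closedBall (0 : Plane) 1)).mono_set
      Metric.ball_subset_closedBall
  have cf := hf.contDiff.continuous
  have af := continuous_angularDeriv hf.contDiff
  have ag := continuous_angularDeriv hg.contDiff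
  have cs := (contDiff_inv_regSq hδ).continuous
  have pf := fun j => (hf.contDiff_partialDeriv j).continuous
  have pg := fun j => (hg.contDiff_partialDeriv j).continuous
  have pf0 := pf 0
  have pf1 := pf 1
  have pg0 := pg 0
  have pg1 := pg 1
  rw [hf.integral_log_mul_det hg hδ, neg_neg]
  have h := hf.two_mul_integral_angularDeriv_le hg hδ
  have e : ∫ x in disc, (regSq δ x)⁻¹ *
      (angularDeriv f x ^ 2 + angularDeriv g x ^ 2 - 2 * (f x * angularDeriv g x)) =
      (∫ x in disc, (regSq δ x)⁻¹ * (angularDeriv f x ^ 2 + angularDeriv g x ^ 2)) -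
        ∫ x in disc, (regSq δ x)⁻¹ * (2 * (f x * angularDeriv g x)) := by
    rw [← integral_sub (hcont _ (by fun_prop)) (hcont _ (by fun_prop))]
    congr 1; ext x; ring
  have hle : ∫ x in disc, (regSq δ x)⁻¹ * (angularDeriv f x ^ 2 + angularDeriv g x ^ 2) ≤
      ∫ x in disc, (Buckling.partialDeriv 0 f x ^ 2 + Buckling.partialDeriv 1 f x ^ 2 +
        Buckling.partialDeriv 0 g x ^ 2 + Buckling.partialDeriv 1 g x ^ 2) := by
    refine integral_mono (hcont _ (by fun_prop)) (hcont _ (by fun_prop)) fun x => ?_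
    -- Lagrange's identity: the squared angular derivative plus `(x·∇u)²` is `|x|²|∇u|²`.
    have cauchy : ∀ u : Plane → ℝ, angularDeriv u x ^ 2 ≤
        regSq δ x * (Buckling.partialDeriv 0 u x ^ 2 + Buckling.partialDeriv 1 u x ^ 2) := by
      intro u
      simp only [angularDeriv, regSq]
      nlinarith [sq_nonneg (x 0 * Buckling.partialDeriv 0 u x + x 1 * Buckling.partialDeriv 1 u x),
        sq_nonneg (δ * Buckling.partialDeriv 0 u x), sq_nonneg (δ * Buckling.partialDeriv 1 u x)]
    rw [inv_mul_le_iff₀ (regSq_pos hδ x)]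
    linarith [cauchy f, cauchy g]
  linarith

end TestIdentities

/-! ### Passage to the limit in `L²` -/

section Limits

/-- Convergence in `L²` of both factors gives convergence of the integral of the product. -/
theorem tendsto_integral_mul_of_tendsto_eLpNorm {α : Type*} [MeasurableSpace α] {μ : Measure α}
    {f g : ℕ → α → ℝ} {F G : α → ℝ} (hf : ∀ n, MemLp (f n) 2 μ) (hg : ∀ n, MemLp (g n) 2 μ)
    (hF : MemLp F 2 μ) (hG : MemLp G 2 μ)
    (hfF : Tendsto (fun n => eLpNorm (f n - F) 2 μ) atTop (𝓝 0))
    (hgG : Tendsto (fun n => eLpNorm (g n - G) 2 μ) atTop (𝓝 0)) :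
    Tendsto (fun n => ∫ x, f n x * g n x ∂μ) atTop (𝓝 (∫ x, F x * G x ∂μ)) := by
  have h1 := (Lp.tendsto_Lp_iff_tendsto_eLpNorm'' f hf F hF).2 hfF
  have h2 := (Lp.tendsto_Lp_iff_tendsto_eLpNorm'' g hg G hG).2 hgG
  have h3 := h1.inner (𝕜 := ℝ) h2
  have e : ∀ {u v : α → ℝ} (hu : MemLp u 2 μ) (hv : MemLp v 2 μ),
      inner ℝ (hu.toLp u) (hv.toLp v) = ∫ x, u x * v x ∂μ := by
    intro u v hu hv
    rw [L2.inner_def]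
    refine integral_congr_ae ?_
    filter_upwards [hu.coeFn_toLp, hv.coeFn_toLp] with x hx hx'
    rw [hx, hx']
    simp [mul_comm]
  simpa only [e] using h3

theorem memLp_mul_continuous {c F : Plane → ℝ} (hc : Continuous c) (hF : MemLp F 2 discMeasure) :
    MemLp (fun x => c x * F x) 2 discMeasure := by
  obtain ⟨C, hC⟩ := (isCompact_closedBall (0 : Plane) 1).exists_bound_of_continuousOn
    hc.continuousOn
  refine hF.of_le_mul (c := C) (hc.aestronglyMeasurable.mul hF.1) ?_
  rw [ae_restrict_iff' measurableSet_ball]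
  refine ae_of_all _ fun x hx => ?_
  rw [norm_mul]
  exact mul_le_mul_of_nonneg_right (hC x (Metric.ball_subset_closedBall hx)) (norm_nonneg _)

theorem tendsto_eLpNorm_mul_continuous {c : Plane → ℝ} {f : ℕ → Plane → ℝ} {F : Plane → ℝ}
    (hc : Continuous c)
    (hfF : Tendsto (fun n => eLpNorm (f n - F) 2 discMeasure) atTop (𝓝 0)) :
    Tendsto (fun n => eLpNorm ((fun x => c x * f n x) - fun x => c x * F x) 2 discMeasure)
      atTop (𝓝 0) := by
  obtain ⟨C, hC⟩ := (isCompact_closedBall (0 : Plane) 1).exists_bound_of_continuousOn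
    hc.continuousOn
  have hb : ∀ n, eLpNorm ((fun x => c x * f n x) - fun x => c x * F x) 2 discMeasure ≤
      ENNReal.ofReal C * eLpNorm (f n - F) 2 discMeasure := by
    intro n
    refine eLpNorm_le_mul_eLpNorm_of_ae_le_mul ?_ 2
    rw [ae_restrict_iff' measurableSet_ball]
    refine ae_of_all _ fun x hx => ?_
    simp only [Pi.sub_apply, ← mul_sub, norm_mul]
    exact mul_le_mul_of_nonneg_right (hC x (Metric.ball_subset_closedBall hx)) (norm_nonneg _)
  have h0 := ENNReal.Tendsto.const_mul (a := ENNReal.ofReal C) hfF (Or.inr ENNReal.ofReal_ne_top)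
  rw [mul_zero] at h0
  exact tendsto_of_tendsto_of_tendsto_of_le_of_le tendsto_const_nhds h0 (fun _ => zero_le)
    hb

end Limits

/-! ### Identities and inequalities for limits of gradients -/

/-- `H` is the limit in `L²` of gradients of the test functions `ψ n`. -/
structure IsGradientLimit (ψ : ℕ → Plane → Plane) (H : Plane → Matrix (Fin 2) (Fin 2) ℝ) :
    Prop where
  isTestFunction : ∀ n, IsTestFunction (ψ n)
  memLp : ∀ i j, MemLp (fun x => H x i j) 2 discMeasure
  tendsto : ∀ i j, Tendsto (fun n => eLpNorm
    (fun x => partialDeriv j (ψ n) x i - H x i j) 2 discMeasure) atTop (𝓝 0)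

theorem integral_add_add_add {α : Type*} [MeasurableSpace α] {μ : Measure α} {a b c d : α → ℝ}
    (ha : Integrable a μ) (hb : Integrable b μ) (hc : Integrable c μ) (hd : Integrable d μ) :
    ∫ x, (a x + b x + c x + d x) ∂μ =
      (∫ x, a x ∂μ) + (∫ x, b x ∂μ) + (∫ x, c x ∂μ) + ∫ x, d x ∂μ := by
  have h1 : Integrable (fun x => a x + b x) μ := ha.add hb
  have h2 : Integrable (fun x => a x + b x + c x) μ := h1.add hc
  rw [integral_add h2 hd, integral_add h1 hc, integral_add ha hb]

theorem memLp_continuous {c : Plane → ℝ} (hc : Continuous c) : MemLp c 2 discMeasure := by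
  have : IsFiniteMeasure discMeasure := ⟨by simp [discMeasure]⟩
  simpa using memLp_mul_continuous hc (memLp_const (1 : ℝ))

theorem memLp_apply {v : Plane → Plane} (hv : MemLp v 2 discMeasure) (i : Fin 2) :
    MemLp (fun x => v x i) 2 discMeasure :=
  hv.of_le ((PiLp.continuous_apply 2 _ i).comp_aestronglyMeasurable hv.1)
    (ae_of_all _ fun _ => PiLp.norm_apply_le _ _)

namespace IsGradientLimit

variable {ψ : ℕ → Plane → Plane} {H : Plane → Matrix (Fin 2) (Fin 2) ℝ} {δ : ℝ}

theorem memLp_partialDeriv (h : IsGradientLimit ψ H) (n : ℕ) (i j : Fin 2) :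
    MemLp (partialDeriv j fun y => ψ n y i) 2 discMeasure :=
  (((h.isTestFunction n).apply i).partialDeriv j).memLp

theorem tendsto_partialDeriv (h : IsGradientLimit ψ H) (i j : Fin 2) :
    Tendsto (fun n => eLpNorm ((partialDeriv j fun y => ψ n y i) - fun x => H x i j) 2
      discMeasure) atTop (𝓝 0) := by
  refine (h.tendsto i j).congr fun n => ?_
  congr 1
  ext x
  have hd : DifferentiableAt ℝ (ψ n) x :=
    (h.isTestFunction n).contDiff.differentiable (by simp) x
  rw [Pi.sub_apply, partialDeriv_apply hd]

theorem tendsto_integral_mul (h : IsGradientLimit ψ H) {c : Plane → ℝ} (hc : Continuous c)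
    (i j : Fin 2) :
    Tendsto (fun n => ∫ x in disc, c x * partialDeriv j (fun y => ψ n y i) x) atTop
      (𝓝 (∫ x in disc, c x * H x i j)) :=
  tendsto_integral_mul_of_tendsto_eLpNorm (fun _ => memLp_continuous hc)
    (fun n => h.memLp_partialDeriv n i j) (memLp_continuous hc) (h.memLp i j)
    (by simp) (h.tendsto_partialDeriv i j)

theorem tendsto_integral_mul_mul (h : IsGradientLimit ψ H) {c : Plane → ℝ} (hc : Continuous c)
    (i j k l : Fin 2) :
    Tendsto (fun n => ∫ x in disc, (c x * partialDeriv j (fun y => ψ n y i) x) *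
        partialDeriv l (fun y => ψ n y k) x) atTop
      (𝓝 (∫ x in disc, (c x * H x i j) * H x k l)) :=
  tendsto_integral_mul_of_tendsto_eLpNorm
    (fun n => memLp_mul_continuous hc (h.memLp_partialDeriv n i j))
    (fun n => h.memLp_partialDeriv n k l) (memLp_mul_continuous hc (h.memLp i j)) (h.memLp k l)
    (tendsto_eLpNorm_mul_continuous hc (h.tendsto_partialDeriv i j)) (h.tendsto_partialDeriv k l)

theorem integrable_mul (h : IsGradientLimit ψ H) {c : Plane → ℝ} (hc : Continuous c)
    (i j : Fin 2) : Integrable (fun x => c x * H x i j) discMeasure :=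
  (memLp_continuous hc).integrable_mul (h.memLp i j)

theorem integrable_mul_mul (h : IsGradientLimit ψ H) {c : Plane → ℝ} (hc : Continuous c)
    (i j k l : Fin 2) : Integrable (fun x => (c x * H x i j) * H x k l) discMeasure :=
  (memLp_mul_continuous hc (h.memLp i j)).integrable_mul (h.memLp k l)

theorem integrable (h : IsGradientLimit ψ H) (i j : Fin 2) :
    Integrable (fun x => H x i j) discMeasure := by
  simpa using h.integrable_mul (c := fun _ => 1) continuous_const i j

theorem integrable_sq (h : IsGradientLimit ψ H) (i j : Fin 2) :
    Integrable (fun x => H x i j ^ 2) discMeasure := (h.memLp i j).integrable_sq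

theorem integral_eq_zero (h : IsGradientLimit ψ H) (i j : Fin 2) :
    ∫ x in disc, H x i j = 0 := by
  have h1 := h.tendsto_integral_mul (c := fun _ => 1) continuous_const i j
  simp only [one_mul, ((h.isTestFunction _).apply i).integral_partialDeriv] at h1
  exact (tendsto_nhds_unique h1 tendsto_const_nhds)

theorem integral_weight (h : IsGradientLimit ψ H) (hδ : 0 < δ) (i : Fin 2) :
    (∫ x in disc, ((x i * x 0) * (regSq δ x)⁻¹) * H x i 0) +
      ∫ x in disc, ((x i * x 1) * (regSq δ x)⁻¹) * H x i 1 =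
    ∫ x in disc, (2⁻¹ * Real.log (regSq δ x) - δ ^ 2 * (regSq δ x)⁻¹) * H x i i := by
  have hl := (contDiff_log_regSq hδ).continuous
  have hs := (contDiff_inv_regSq hδ).continuous
  have hx := fun j : Fin 2 => (contDiff_coord j (n := 0)).continuous
  have hw : ∀ j : Fin 2, Continuous fun x : Plane => (x i * x j) * (regSq δ x)⁻¹ := fun j =>
    ((hx i).mul (hx j)).mul hs
  have h1 := (h.tendsto_integral_mul (hw 0) i 0).add (h.tendsto_integral_mul (hw 1) i 1)
  simp only [((h.isTestFunction _).apply i).integral_weight_mul_partialDeriv hδ] at h1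
  exact tendsto_nhds_unique h1 (h.tendsto_integral_mul
    ((continuous_const.mul hl).sub (continuous_const.mul hs)) i i)

theorem integral_sum_sq (h : IsGradientLimit ψ H) :
    ∫ x in disc, (H x 0 0 ^ 2 + H x 0 1 ^ 2 + H x 1 0 ^ 2 + H x 1 1 ^ 2) =
      (∫ x in disc, H x 0 0 ^ 2) + (∫ x in disc, H x 0 1 ^ 2) + (∫ x in disc, H x 1 0 ^ 2) +
        ∫ x in disc, H x 1 1 ^ 2 := by
  have q := h.integrable_sq
  exact integral_add_add_add (q 0 0) (q 0 1) (q 1 0) (q 1 1)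

/-- For fixed `δ` the logarithm is bounded on the disc, so both sides are continuous under `L²`
convergence of the gradients. -/
theorem neg_integral_log_mul_det_le (h : IsGradientLimit ψ H) (hδ : 0 < δ) :
    - ∫ x in disc, Real.log (regSq δ x) * (H x 0 0 * H x 1 1 - H x 0 1 * H x 1 0) ≤
      ∫ x in disc, (H x 0 0 ^ 2 + H x 0 1 ^ 2 + H x 1 0 ^ 2 + H x 1 1 ^ 2) := by
  have hl := (contDiff_log_regSq hδ).continuous
  have L := ((h.tendsto_integral_mul_mul hl 0 0 1 1).sub
    (h.tendsto_integral_mul_mul hl 0 1 1 0)).neg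
  have c1 : Continuous fun _ : Plane => (1 : ℝ) := continuous_const
  have R := (((h.tendsto_integral_mul_mul c1 0 0 0 0).add
    (h.tendsto_integral_mul_mul c1 0 1 0 1)).add (h.tendsto_integral_mul_mul c1 1 0 1 0)).add (h.tendsto_integral_mul_mul c1 1 1 1 1)
  simp only [one_mul, ← pow_two] at R
  rw [← h.integral_sum_sq] at R
  rw [← integral_sub (h.integrable_mul_mul hl 0 0 1 1) (h.integrable_mul_mul hl 0 1 1 0)] at L
  simp only [mul_assoc, ← mul_sub] at L
  refine le_of_tendsto_of_tendsto' L R fun n => ?_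
  have f := (h.isTestFunction n).apply 0
  have g := (h.isTestFunction n).apply 1
  have q : ∀ i j, Integrable (fun x => partialDeriv j (fun y => ψ n y i) x ^ 2) discMeasure :=
    fun i j => (h.memLp_partialDeriv n i j).integrable_sq
  have key := f.neg_integral_log_mul_det_le g hδ
  rw [integral_add_add_add (q 0 0) (q 0 1) (q 1 0) (q 1 1)] at key
  refine le_trans (le_of_eq ?_) key
  have i1 : ∀ i j k l, Integrable (fun x => Real.log (regSq δ x) *
      (partialDeriv j (fun y => ψ n y i) x * partialDeriv l (fun y => ψ n y k) x)) discMeasure := by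
    intro i j k l
    simp only [← mul_assoc]
    exact (memLp_mul_continuous hl (h.memLp_partialDeriv n i j)).integrable_mul
      (h.memLp_partialDeriv n k l)
  rw [← integral_sub (i1 0 0 1 1) (i1 0 1 1 0)]
  simp only [← mul_sub]

theorem integral_sq_le (h : IsGradientLimit ψ H) {u : Plane → Plane} (hu : MemLp u 2 discMeasure)
    (hψ : Tendsto (fun n => eLpNorm (ψ n - u) 2 discMeasure) atTop (𝓝 0)) (i : Fin 2) :
    ∫ x in disc, u x i ^ 2 ≤ 4 * ∫ x in disc, H x i 0 ^ 2 := by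
  have hui := memLp_apply hu i
  have hlim : Tendsto (fun n => eLpNorm ((fun x => ψ n x i) - fun x => u x i) 2 discMeasure)
      atTop (𝓝 0) :=
    tendsto_of_tendsto_of_tendsto_of_le_of_le tendsto_const_nhds hψ (fun _ => zero_le)
      fun n => eLpNorm_mono fun x => PiLp.norm_apply_le (ψ n x - u x) i
  have L := tendsto_integral_mul_of_tendsto_eLpNorm
    (fun n => ((h.isTestFunction n).apply i).memLp) (fun n => ((h.isTestFunction n).apply i).memLp)
    hui hui hlim hlim
  have R := (tendsto_integral_mul_of_tendsto_eLpNorm (fun n => h.memLp_partialDeriv n i 0)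
    (fun n => h.memLp_partialDeriv n i 0) (h.memLp i 0) (h.memLp i 0)
    (h.tendsto_partialDeriv i 0) (h.tendsto_partialDeriv i 0)).const_mul 4
  simp only [← pow_two] at L R
  exact le_of_tendsto_of_tendsto' L R fun n => ((h.isTestFunction n).apply i).integral_sq_le

/-- The regularised form of `∫ x̂·Hx̂ ≤ ½ ∫ |H|²`; the second integral on the left is the error of
the regularisation and disappears as `δ → 0`. -/
theorem integral_regularized_le (h : IsGradientLimit ψ H)
    (hdet : ∀ᵐ x ∂discMeasure, H x 0 0 + H x 1 1 = -(H x 0 0 * H x 1 1 - H x 0 1 * H x 1 0))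
    (hδ : 0 < δ) :
    (∫ x in disc, (((x 0 * x 0) * (regSq δ x)⁻¹) * H x 0 0 +
        ((x 0 * x 1) * (regSq δ x)⁻¹) * H x 0 1 + ((x 1 * x 0) * (regSq δ x)⁻¹) * H x 1 0 +
        ((x 1 * x 1) * (regSq δ x)⁻¹) * H x 1 1)) +
      ∫ x in disc, (δ ^ 2 * (regSq δ x)⁻¹) * (H x 0 0 + H x 1 1) ≤
    2⁻¹ * ∫ x in disc, (H x 0 0 ^ 2 + H x 0 1 ^ 2 + H x 1 0 ^ 2 + H x 1 1 ^ 2) := by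
  have hl := (contDiff_log_regSq hδ).continuous
  have hs := (contDiff_inv_regSq hδ).continuous
  have hx := fun j : Fin 2 => (contDiff_coord j (n := 0)).continuous
  have hw : ∀ i j : Fin 2, Continuous fun x : Plane => (x i * x j) * (regSq δ x)⁻¹ := fun i j =>
    ((hx i).mul (hx j)).mul hs
  have iw := fun i j => h.integrable_mul (hw i j) i j
  have ir : ∀ i, Integrable (fun x => δ ^ 2 * (regSq δ x)⁻¹ * H x i i) discMeasure :=
    fun i => h.integrable_mul (continuous_const.mul hs) i i
  have il : ∀ i, Integrable (fun x => 2⁻¹ * Real.log (regSq δ x) * H x i i) discMeasure :=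
    fun i => h.integrable_mul (continuous_const.mul hl) i i
  have e0 := h.integral_weight hδ 0
  have e1 := h.integral_weight hδ 1
  have hN := h.neg_integral_log_mul_det_le hδ
  -- Incompressibility enters here: the trace is replaced by minus the determinant.
  have hlog : (∫ x in disc, (2⁻¹ * Real.log (regSq δ x)) * H x 0 0) +
      (∫ x in disc, (2⁻¹ * Real.log (regSq δ x)) * H x 1 1) =
      2⁻¹ * - ∫ x in disc, Real.log (regSq δ x) * (H x 0 0 * H x 1 1 - H x 0 1 * H x 1 0) := by
    rw [← integral_add (il 0) (il 1), ← integral_neg, ← integral_const_mul]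
    refine integral_congr_ae ?_
    filter_upwards [hdet] with x hx
    rw [← mul_add, hx]
    ring
  simp only [sub_mul] at e0 e1
  rw [integral_sub (il 0) (ir 0)] at e0
  rw [integral_sub (il 1) (ir 1)] at e1
  simp only [mul_add]
  rw [integral_add_add_add (iw 0 0) (iw 0 1) (iw 1 0) (iw 1 1), integral_add (ir 0) (ir 1)]
  linarith

end IsGradientLimit

/-! ### Radial direction and pointwise expansion of the integrand -/

section Radial

theorem radial_apply (x : Plane) (i : Fin 2) : radial x i = ‖x‖⁻¹ * x i := rfl

theorem abs_radial_le (x : Plane) (i : Fin 2) : |radial x i| ≤ 1 := by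
  rw [radial_apply, abs_mul, abs_inv, abs_norm]
  have h : |x i| ≤ ‖x‖ := PiLp.norm_apply_le x i
  exact (mul_le_mul_of_nonneg_left h (inv_nonneg.2 (norm_nonneg x))).trans (inv_mul_le_one)

theorem measurable_radial (i : Fin 2) : Measurable fun x => radial x i :=
  measurable_norm.inv.mul (contDiff_coord i (n := 0)).continuous.measurable

theorem radial_sq_add {x : Plane} (hx : x ≠ 0) : radial x 0 ^ 2 + radial x 1 ^ 2 = 1 := by
  have h := norm_sq_eq x
  have h0 : ‖x‖ ≠ 0 := norm_ne_zero_iff.2 hx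
  simp only [radial_apply]
  field_simp
  exact h.symm

theorem memLp_radial_mul {F : Plane → ℝ} (hF : MemLp F 2 discMeasure) (i : Fin 2) :
    MemLp (fun x => radial x i * F x) 2 discMeasure := by
  refine hF.of_le ((measurable_radial i).aestronglyMeasurable.mul hF.1) (ae_of_all _ fun x => ?_)
  rw [norm_mul]
  exact mul_le_of_le_one_left (norm_nonneg _) (abs_radial_le x i)

theorem ae_ne_zero : ∀ᵐ x ∂discMeasure, x ≠ 0 := by
  refine ae_restrict_of_ae ?_
  rw [ae_iff]
  simp

/-- The quadratic form `x̂ · ξ x̂`. -/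
noncomputable def radialForm (ξ : Matrix (Fin 2) (Fin 2) ℝ) (x : Plane) : ℝ :=
  radial x 0 * (radial x 0 * ξ 0 0) + radial x 0 * (radial x 1 * ξ 0 1) +
    radial x 1 * (radial x 0 * ξ 1 0) + radial x 1 * (radial x 1 * ξ 1 1)

theorem integrand_eq (ε : ℝ) (x : Plane) (ξ : Matrix (Fin 2) (Fin 2) ℝ) :
    integrand ε x ξ =
      ε⁻¹ * ((radial x 0 * ξ 0 0 + radial x 1 * ξ 1 0) ^ 2 +
        (radial x 0 * ξ 0 1 + radial x 1 * ξ 1 1) ^ 2) +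
      ε * ((radial x 0 * ξ 1 1 - radial x 1 * ξ 0 1) ^ 2 +
        (radial x 1 * ξ 0 0 - radial x 0 * ξ 1 0) ^ 2) := by
  rw [integrand, norm_sq_eq, norm_sq_eq]
  simp [Matrix.toLpLin_apply, dotProduct, Fin.sum_univ_two, Matrix.adjugate_fin_two]
  ring

/-- The difference of the two sides is exactly `(ε - ε⁻¹)|(adj H)x̂|²`, by `|Hᵀx̂|² + |(adj H)x̂|² =
|H|²` and `x̂·(adj H)x̂ = tr H - x̂·Hx̂`. Both identities need `|x̂| = 1`, hence `x ≠ 0`. -/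
theorem integrand_one_add_ge {ε : ℝ} (hε : 1 ≤ ε) {x : Plane} (hx : x ≠ 0)
    (H : Matrix (Fin 2) (Fin 2) ℝ) :
    integrand ε x 1 + ε⁻¹ * (H 0 0 ^ 2 + H 0 1 ^ 2 + H 1 0 ^ 2 + H 1 1 ^ 2)
      + 2 * ε * (H 0 0 + H 1 1) - 2 * (ε - ε⁻¹) * radialForm H x ≤ integrand ε x (1 + H) := by
  have hr := radial_sq_add hx
  rw [integrand_eq, integrand_eq, radialForm]
  simp only [Matrix.add_apply, Matrix.one_apply_eq, Matrix.one_apply_ne (zero_ne_one (α := Fin 2)),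
    Matrix.one_apply_ne (one_ne_zero (α := Fin 2))]
  generalize radial x 0 = a at *
  generalize radial x 1 = b at *
  have hpos : 0 ≤ ε - ε⁻¹ := by
    have := inv_le_one_of_one_le₀ hε
    linarith
  have key := mul_nonneg hpos (add_nonneg (sq_nonneg (a * H 1 1 - b * H 0 1))
    (sq_nonneg (b * H 0 0 - a * H 1 0)))
  refine sub_nonneg.1 (key.trans (le_of_eq ?_))
  linear_combination (-(ε⁻¹ * (H 0 0 ^ 2 + H 0 1 ^ 2 + H 1 0 ^ 2 + H 1 1 ^ 2)
      + 2 * ε * (H 0 0 + H 1 1))) * hr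

theorem integrable_integrand {G : Plane → Matrix (Fin 2) (Fin 2) ℝ}
    (hG : ∀ i j, MemLp (fun x => G x i j) 2 discMeasure) (ε : ℝ) :
    Integrable (fun x => integrand ε x (G x)) discMeasure := by
  simp only [integrand_eq]
  have m := fun k i j => memLp_radial_mul (hG i j) k
  have i1 := (((m 0 0 0).add (m 1 1 0)).integrable_sq.add
    ((m 0 0 1).add (m 1 1 1)).integrable_sq).const_mul ε⁻¹
  have i2 := (((m 0 1 1).sub (m 1 0 1)).integrable_sq.add
    ((m 1 0 0).sub (m 0 1 0)).integrable_sq).const_mul ε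
  exact i1.add i2

theorem integrable_radialForm {H : Plane → Matrix (Fin 2) (Fin 2) ℝ}
    (hH : ∀ i j, MemLp (fun x => H x i j) 2 discMeasure) :
    Integrable (fun x => radialForm (H x) x) discMeasure := by
  have : IsFiniteMeasure discMeasure := ⟨by simp [discMeasure]⟩
  have m := fun k l i j => (memLp_radial_mul (memLp_radial_mul (hH i j) l) k).integrable
    (by norm_num)
  exact (((m 0 0 0 0).add (m 0 1 0 1)).add (m 1 0 1 0)).add (m 1 1 1 1)

end Radial

/-! ### Removing the regularisation -/

namespace IsGradientLimit

variable {ψ : ℕ → Plane → Plane} {H : Plane → Matrix (Fin 2) (Fin 2) ℝ}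

/-- Dominated convergence as `δ → 0`: the weights `xᵢxⱼ/(|x|² + δ²)` and `δ²/(|x|² + δ²)` are
bounded by 1 and converge off the origin to `x̂ᵢx̂ⱼ` and 0. The logarithm is absent from the
inequality by now. -/
theorem integral_radialForm_le (h : IsGradientLimit ψ H)
    (hdet : ∀ᵐ x ∂discMeasure, H x 0 0 + H x 1 1 = -(H x 0 0 * H x 1 1 - H x 0 1 * H x 1 0)) :
    ∫ x in disc, radialForm (H x) x ≤
      2⁻¹ * ∫ x in disc, (H x 0 0 ^ 2 + H x 0 1 ^ 2 + H x 1 0 ^ 2 + H x 1 1 ^ 2) := by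
  set δ : ℕ → ℝ := fun n => 1 / ((n : ℝ) + 1) with hδdef
  have hδ : ∀ n, 0 < δ n := fun n => by simp only [hδdef]; positivity
  have hδ0 : Tendsto δ atTop (𝓝 0) := tendsto_one_div_add_atTop_nhds_zero_nat
  have hδsq : Tendsto (fun n => δ n ^ 2) atTop (𝓝 0) := by simpa using hδ0.pow 2
  have hreg : ∀ x : Plane, Tendsto (fun n => regSq (δ n) x) atTop (𝓝 (‖x‖ ^ 2)) := by
    intro x
    have := hδsq.const_add (x 0 ^ 2 + x 1 ^ 2)
    rw [add_zero, ← norm_sq_eq] at this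
    simpa only [regSq, ← norm_sq_eq] using this
  have hinv : ∀ x : Plane, x ≠ 0 →
      Tendsto (fun n => (regSq (δ n) x)⁻¹) atTop (𝓝 ((‖x‖ ^ 2)⁻¹)) := fun x hx =>
    (hreg x).inv₀ (pow_ne_zero 2 (norm_ne_zero_iff.2 hx))
  have hw : ∀ n (i j : Fin 2), Continuous fun x : Plane => (x i * x j) * (regSq (δ n) x)⁻¹ :=
    fun n i j => (((contDiff_coord i (n := 0)).continuous).mul
      ((contDiff_coord j (n := 0)).continuous)).mul (contDiff_inv_regSq (hδ n)).continuous
  have hbw : ∀ n (i j : Fin 2) (x : Plane), ‖(x i * x j) * (regSq (δ n) x)⁻¹‖ ≤ 1 := by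
    intro n i j x
    rw [norm_mul, norm_inv, Real.norm_of_nonneg (regSq_pos (hδ n) x).le,
      ← div_eq_mul_inv, div_le_one (regSq_pos (hδ n) x), norm_mul]
    calc ‖x i‖ * ‖x j‖ ≤ ‖x‖ * ‖x‖ := mul_le_mul (PiLp.norm_apply_le x i)
          (PiLp.norm_apply_le x j) (norm_nonneg _) (norm_nonneg _)
      _ = x 0 ^ 2 + x 1 ^ 2 := by rw [← pow_two, norm_sq_eq]
      _ ≤ regSq (δ n) x := le_add_of_nonneg_right (sq_nonneg _)
  have hiw : ∀ n i j, Integrable (fun x => (x i * x j) * (regSq (δ n) x)⁻¹ * H x i j)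
      discMeasure := fun n i j => h.integrable_mul (hw n i j) i j
  have hb : ∀ n i j x, ‖(x i * x j) * (regSq (δ n) x)⁻¹ * H x i j‖ ≤ ‖H x i j‖ := by
    intro n i j x
    rw [norm_mul]
    exact mul_le_of_le_one_left (norm_nonneg _) (hbw n i j x)
  have T1 : Tendsto (fun n => ∫ x in disc, (((x 0 * x 0) * (regSq (δ n) x)⁻¹) * H x 0 0 +
        ((x 0 * x 1) * (regSq (δ n) x)⁻¹) * H x 0 1 + ((x 1 * x 0) * (regSq (δ n) x)⁻¹) * H x 1 0 +
        ((x 1 * x 1) * (regSq (δ n) x)⁻¹) * H x 1 1)) atTop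
      (𝓝 (∫ x in disc, radialForm (H x) x)) := by
    refine tendsto_integral_of_dominated_convergence
      (fun x => ‖H x 0 0‖ + ‖H x 0 1‖ + ‖H x 1 0‖ + ‖H x 1 1‖)
      (fun n => ((((hiw n 0 0).add (hiw n 0 1)).add (hiw n 1 0)).add (hiw n 1 1)).1)
      ((((h.integrable 0 0).norm.add (h.integrable 0 1).norm).add
        (h.integrable 1 0).norm).add (h.integrable 1 1).norm)
      (fun n => ae_of_all _ fun x => ?_) ?_
    · refine (norm_add_le _ _).trans (add_le_add ((norm_add_le _ _).trans (add_le_add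
        ((norm_add_le _ _).trans (add_le_add ?_ ?_)) ?_)) ?_) <;> exact hb n _ _ x
    · filter_upwards [ae_ne_zero] with x hx
      have t : ∀ i j, Tendsto (fun n => (x i * x j) * (regSq (δ n) x)⁻¹ * H x i j) atTop
          (𝓝 (radial x i * (radial x j * H x i j))) := by
        intro i j
        have := ((hinv x hx).const_mul (x i * x j)).mul_const (H x i j)
        convert this using 2
        simp only [radial_apply, ← inv_pow]
        ring
      exact (((t 0 0).add (t 0 1)).add (t 1 0)).add (t 1 1)
  have T2 : Tendsto (fun n => ∫ x in disc, (δ n ^ 2 * (regSq (δ n) x)⁻¹) * (H x 0 0 + H x 1 1))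
      atTop (𝓝 (∫ x in disc, (0 : ℝ))) := by
    have htr : Integrable (fun x => H x 0 0 + H x 1 1) discMeasure :=
      (h.integrable 0 0).add (h.integrable 1 1)
    refine tendsto_integral_of_dominated_convergence (fun x => ‖H x 0 0 + H x 1 1‖)
      (fun n => ((continuous_const.mul (contDiff_inv_regSq
        (hδ n)).continuous).aestronglyMeasurable).mul htr.1) htr.norm
      (fun n => ae_of_all _ fun x => ?_) ?_
    · rw [norm_mul]
      refine mul_le_of_le_one_left (norm_nonneg _) ?_
      rw [norm_mul, norm_inv, Real.norm_of_nonneg (regSq_pos (hδ n) x).le,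
        Real.norm_of_nonneg (sq_nonneg _), ← div_eq_mul_inv, div_le_one (regSq_pos (hδ n) x)]
      exact le_add_of_nonneg_left (by positivity)
    · filter_upwards [ae_ne_zero] with x hx
      simpa using (hδsq.mul (hinv x hx)).mul_const (H x 0 0 + H x 1 1)
  have T := T1.add T2
  rw [integral_zero, add_zero] at T
  exact le_of_tendsto' T fun n => h.integral_regularized_le hdet (hδ n)

end IsGradientLimit

/-! ### Weak gradients and admissibility of the identity -/

section Gradients

theorem HasWeakGradient.memW12 {v : Plane → Plane} {G : Plane → Matrix (Fin 2) (Fin 2) ℝ}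
    (hG : HasWeakGradient v G) (hv : MemLp v 2 discMeasure) : MemW12 v :=
  ⟨hv, G, hG⟩

theorem HasWeakGradient.weakGradient_ae_eq {v : Plane → Plane}
    {G : Plane → Matrix (Fin 2) (Fin 2) ℝ} (hG : HasWeakGradient v G)
    (hv : MemLp v 2 discMeasure) : weakGradient v =ᵐ[discMeasure] G :=
  (hG.memW12 hv).hasWeakGradient.ae_eq hG

theorem hasWeakGradient_id : HasWeakGradient id fun _ => 1 where
  memLp i j := memLp_continuous continuous_const
  integral_eq i j φ hφ := by
    simp only [id]
    rw [hφ.integral_mul_partialDeriv (contDiff_coord i)]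
    simp only [partialDeriv_coord, Matrix.one_apply]

theorem memLp_id : MemLp (id : Plane → Plane) 2 discMeasure := by
  have : IsFiniteMeasure discMeasure := ⟨by simp [discMeasure]⟩
  refine MemLp.of_bound continuous_id.aestronglyMeasurable 1 ?_
  rw [ae_restrict_iff' measurableSet_ball]
  exact ae_of_all _ fun _ hx => (mem_ball_zero_iff.1 hx).le

theorem HasWeakGradient.sub {v w : Plane → Plane} {G K : Plane → Matrix (Fin 2) (Fin 2) ℝ}
    (hG : HasWeakGradient v G) (hK : HasWeakGradient w K) (hv : MemLp v 2 discMeasure)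
    (hw : MemLp w 2 discMeasure) : HasWeakGradient (v - w) fun x => G x - K x where
  memLp i j := (hG.memLp i j).sub (hK.memLp i j)
  integral_eq i j φ hφ := by
    have i1 : ∀ u : Plane → Plane, MemLp u 2 discMeasure →
        Integrable (fun x => u x i * partialDeriv j φ x) discMeasure := fun u hu =>
      (memLp_apply hu i).integrable_mul (hφ.partialDeriv j).memLp
    have i2 : ∀ L : Plane → Matrix (Fin 2) (Fin 2) ℝ, MemLp (fun x => L x i j) 2 discMeasure →
        Integrable (fun x => L x i j * φ x) discMeasure := fun L hL =>
      hL.integrable_mul hφ.memLp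
    simp only [Pi.sub_apply, PiLp.sub_apply, Matrix.sub_apply, sub_mul]
    rw [integral_sub (i1 v hv) (i1 w hw), integral_sub (i2 G (hG.memLp i j)) (i2 K (hK.memLp i j)),
      hG.integral_eq i j φ hφ, hK.integral_eq i j φ hφ]
    ring

theorem memW120_zero : MemW120 0 := by
  have h0 : HasWeakGradient (0 : Plane → Plane) 0 :=
    ⟨fun i j => by simp, fun i j φ _ => by simp⟩
  have hz : MemLp (0 : Plane → Plane) 2 discMeasure := MemLp.zero'
  refine ⟨h0.memW12 hz, fun _ => 0, fun _ => ⟨contDiff_const, HasCompactSupport.zero, by simp⟩,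
    by simp, fun i j => ?_⟩
  refine tendsto_const_nhds.congr fun n => ?_
  symm
  rw [eLpNorm_congr_ae (g := 0), eLpNorm_zero]
  filter_upwards [h0.weakGradient_ae_eq hz] with x hx
  simp [hx, partialDeriv]

theorem id_mem_admissible : id ∈ admissible := by
  have hid : MemW12 id := hasWeakGradient_id.memW12 memLp_id
  refine ⟨⟨hid, ?_⟩, hid, by rw [sub_self]; exact memW120_zero⟩
  filter_upwards [hasWeakGradient_id.weakGradient_ae_eq memLp_id] with x hx
  rw [hx, Matrix.det_one]

end Gradients

/-! ### Excess energy and the conclusion -/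

/-- The excess energy of an admissible map over the identity controls the Dirichlet energy of
its deviation from the identity, hence its `L²` distance to the identity. -/
theorem energy_excess {ε : ℝ} (hε : 1 ≤ ε) {v : Plane → Plane} (hv : v ∈ admissible) :
    ∃ N : ℝ, 0 ≤ N ∧ energy ε id + (2 * ε⁻¹ - ε) * N ≤ energy ε v ∧
      ∀ i, ∫ x in disc, (v x - x) i ^ 2 ≤ 4 * N := by
  obtain ⟨⟨hvW, hdetv⟩, -, huW, ψ, hψ, hψu, hψH⟩ := hv
  set H := weakGradient (v - id) with hHdef
  have h : IsGradientLimit ψ H := ⟨hψ, huW.hasWeakGradient.memLp, hψH⟩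
  have hH : H =ᵐ[discMeasure] fun x => weakGradient v x - 1 :=
    huW.hasWeakGradient.ae_eq (hvW.hasWeakGradient.sub hasWeakGradient_id hvW.1 memLp_id)
  have hdet : ∀ᵐ x ∂discMeasure,
      H x 0 0 + H x 1 1 = -(H x 0 0 * H x 1 1 - H x 0 1 * H x 1 0) := by
    filter_upwards [hH, hdetv] with x hx hd
    rw [Matrix.det_fin_two] at hd
    simp [hx]
    linarith
  have hQ : Integrable (fun x => H x 0 0 ^ 2 + H x 0 1 ^ 2 + H x 1 0 ^ 2 + H x 1 1 ^ 2)
      discMeasure := (((h.integrable_sq 0 0).add (h.integrable_sq 0 1)).add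
    (h.integrable_sq 1 0)).add (h.integrable_sq 1 1)
  set N := ∫ x in disc, (H x 0 0 ^ 2 + H x 0 1 ^ 2 + H x 1 0 ^ 2 + H x 1 1 ^ 2) with hN
  have hR := h.integral_radialForm_le hdet
  have iR := integrable_radialForm h.memLp
  refine ⟨N, integral_nonneg fun x => by positivity, ?_, fun i => ?_⟩
  · have itr : Integrable (fun x => H x 0 0 + H x 1 1) discMeasure :=
      (h.integrable 0 0).add (h.integrable 1 1)
    have htr : ∫ x in disc, (H x 0 0 + H x 1 1) = 0 := by
      rw [integral_add (h.integrable 0 0) (h.integrable 1 1), h.integral_eq_zero,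
        h.integral_eq_zero, add_zero]
    have eid : energy ε id = ∫ x in disc, integrand ε x 1 := by
      refine integral_congr_ae ?_
      filter_upwards [hasWeakGradient_id.weakGradient_ae_eq memLp_id] with x hx
      rw [hx]
    have i1 : Integrable (fun x => integrand ε x 1) discMeasure :=
      integrable_integrand hasWeakGradient_id.memLp ε
    have i2 : Integrable (fun x => integrand ε x 1 +
        ε⁻¹ * (H x 0 0 ^ 2 + H x 0 1 ^ 2 + H x 1 0 ^ 2 + H x 1 1 ^ 2)) discMeasure :=
      i1.add (hQ.const_mul _)
    have i3 : Integrable (fun x => integrand ε x 1 +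
        ε⁻¹ * (H x 0 0 ^ 2 + H x 0 1 ^ 2 + H x 1 0 ^ 2 + H x 1 1 ^ 2) +
        2 * ε * (H x 0 0 + H x 1 1)) discMeasure := i2.add (itr.const_mul _)
    -- Integrating the pointwise expansion: the trace term vanishes and the radial term costs at
    -- most `(ε - ε⁻¹)N`, leaving `ε⁻¹ - (ε - ε⁻¹) = 2ε⁻¹ - ε` in front of `N`.
    have hle : ∫ x in disc, (integrand ε x 1 +
        ε⁻¹ * (H x 0 0 ^ 2 + H x 0 1 ^ 2 + H x 1 0 ^ 2 + H x 1 1 ^ 2) +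
        2 * ε * (H x 0 0 + H x 1 1) - 2 * (ε - ε⁻¹) * radialForm (H x) x) ≤ energy ε v := by
      refine integral_mono_ae (i3.sub (iR.const_mul _))
        (integrable_integrand hvW.hasWeakGradient.memLp ε) ?_
      filter_upwards [hH, ae_ne_zero] with x hx hx0
      have := integrand_one_add_ge hε hx0 (H x)
      have e : 1 + H x = weakGradient v x := by rw [hx]; abel
      rwa [e] at this
    rw [integral_sub i3 (iR.const_mul _), integral_add i2 (itr.const_mul _),
      integral_add i1 (hQ.const_mul _), integral_const_mul, integral_const_mul,
      integral_const_mul, htr, ← eid, ← hN] at hle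
    have hpos : 0 ≤ ε - ε⁻¹ := by
      have := inv_le_one_of_one_le₀ hε
      linarith
    have := mul_le_mul_of_nonneg_left hR hpos
    linarith
  · refine (h.integral_sq_le huW.1 hψu i).trans
      (mul_le_mul_of_nonneg_left (integral_mono (h.integrable_sq i 0) hQ fun x => ?_) (by norm_num))
    fin_cases i <;> simp <;> nlinarith [sq_nonneg (H x 0 0), sq_nonneg (H x 0 1),
      sq_nonneg (H x 1 0), sq_nonneg (H x 1 1)]

theorem isGlobalMinimizer_id {ε : ℝ} (hε : 1 ≤ ε) (hε2 : ε ^ 2 ≤ 2) : IsGlobalMinimizer ε id := by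
  refine ⟨id_mem_admissible, fun v hv => ?_⟩
  obtain ⟨N, hN, hle, -⟩ := energy_excess hε hv
  have hpos : 0 < ε := by linarith
  have : 0 ≤ 2 * ε⁻¹ - ε := by
    rw [sub_nonneg, ← div_eq_mul_inv, le_div_iff₀ hpos]
    linarith
  linarith [mul_nonneg this hN]

theorem IsGlobalMinimizer.ae_eq_id {ε : ℝ} (hε : 1 ≤ ε) (hε2 : ε ^ 2 < 2) {v : Plane → Plane}
    (hv : IsGlobalMinimizer ε v) : v =ᵐ[discMeasure] id := by
  obtain ⟨N, hN, hle, hP⟩ := energy_excess hε hv.1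
  have hpos : 0 < ε := by linarith
  have hc : 0 < 2 * ε⁻¹ - ε := by
    rw [sub_pos, ← div_eq_mul_inv, lt_div_iff₀ hpos]
    linarith
  -- The energy of a minimizer does not exceed that of the identity, while the excess is at least a
  -- positive multiple of `N`.
  have hN0 : N = 0 := by
    refine le_antisymm (nonpos_of_mul_nonpos_right ?_ hc) hN
    linarith [hv.2 id id_mem_admissible]
  have hz : ∀ i, ∀ᵐ x ∂discMeasure, (v x - x) i = 0 := by
    intro i
    have h0 : ∫ x in disc, (v x - x) i ^ 2 = 0 :=
      le_antisymm (by simpa [hN0] using hP i) (integral_nonneg fun x => sq_nonneg _)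
    have hi := (memLp_apply hv.1.2.2.1.1 i).integrable_sq
    simp only [Pi.sub_apply, id] at hi
    filter_upwards [(integral_eq_zero_iff_of_nonneg (fun x => sq_nonneg _) hi).1 h0] with x hx
    exact pow_eq_zero_iff (two_ne_zero) |>.1 hx
  filter_upwards [ae_all_iff.2 hz] with x hx
  ext i
  exact sub_eq_zero.1 (hx i)

end Buckling

theorem mainTheorem8 :
    (∀ ε : ℝ, 1 < ε → ε < √2 →
      Buckling.IsGlobalMinimizer ε id ∧
        ∀ v : Buckling.Plane → Buckling.Plane, Buckling.IsGlobalMinimizer ε v →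
          v =ᵐ[Buckling.discMeasure] id) ∧
      Buckling.IsGlobalMinimizer √2 id := by
  refine ⟨fun ε h1 h2 => ?_, Buckling.isGlobalMinimizer_id ?_ (by norm_num)⟩
  · have hsq : ε ^ 2 < 2 := (Real.lt_sqrt (by linarith)).1 h2
    exact ⟨Buckling.isGlobalMinimizer_id h1.le hsq.le, fun v hv => hv.ae_eq_id h1.le hsq⟩
  · exact Real.one_le_sqrt.2 (by norm_num)
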